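/- Let $\Sigma$ be a finite alphabet and $L\subseteq\Sigma^*$ a regular language. The syntactic congruence of $L$ is given by $x\approx_L y$ iff for all $u,v\in\Sigma^*$ ($uxv\in L\Leftrightarrow uyv\in L$); the syntactic monoid of $L$ is $\Sigma^*/{\approx_L}$, its syntactic semigroup is $\Sigma^+/{\approx_L}$, and the syntactic complexity $\sigma(L)$ is the cardinality of the syntactic semigroup. The quotient complexity $\kappa(L)$ is the number of distinct left quotients $L_w=\{x : wx\in L\}$, $w\in\Sigma^*$. A monoid $M$ is $\mathcal J$-trivial if $MsM=MtM$ implies $s=t$ for all $s,t\in M$; $L$ is $\mathcal J$-trivial if its syntactic monoid is. For $n\ge 1$ put $g(n)=\sum_{r=1}^{n}\binom{n-1}{r-1}(n-r)!$ and $Q=\{1,\dots,n\}$. Transformations of $Q$ act on the right, so $i(ts)=(it)s$. Let $\mathcal F_Q$ be the monoid of all transformations $t$ of $Q$ with $p\le pt$ for all $p\in Q$. The orbits of $t$ are the classes of the equivalence relation: $it^k=jt^l$ for some $k,l\ge 0$. For $Z\subseteq Q$ with $n\in Z$, let $\pi_Z$ be the partition of $Q$ into the singletons $\{j\}$, $j\in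 Z\setminus\{n\}$, and the remaining block $(Q\setminus Z)\cup\{n\}$. Let $\mathcal S_n$ be the set of all $t\in\mathcal F_Q$ whose set of orbits is $\pi_Z$ for some $Z\subseteq Q$ with $n\in Z$. Let $t_Z$ be the identity if $Z=Q$; otherwise, with $h=\max(Q\setminus Z)$, let $t_Z$ fix every element of $Z$, map $h$ to $n$, and map every other element to $h$. Let $\mathcal{GS}_n=\{t_Z : n\in Z\subseteq Q\}$. **Theorem.** Let $n\ge 1$. 1. If $L$ is a $\mathcal J$-trivial regular language with $\kappa(L)=n$, then its syntactic semigroup is finite, $\sigma(L)\le g(n)$ and $\sigma(L)\le\lfloor e\,(n-1)!\rfloor$. 2. If $n\ge 2$, then $g(n)=\lfloor e\,(n-1)!\rfloor$. 3. Every $\mathcal J$-trivial submonoid of $\mathcal F_Q$ has at most $g(n)$ elements. 4. $\mathcal S_n$ is a $\mathcal J$-trivial submonoid of $\mathcal F_Q$ with exactly $g(n)$ elements; it is generated by $\mathcal{GS}_n$, which has exactly $2^{n-1}$ elements. 5. The bound $g(n)$ is tight: over every finite alphabet $\Sigma$ with $|\Sigma|\ge 2^{n-1}$ there is a $\mathcal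 J$-trivial regular language $L$ with $\kappa(L)=n$ and $\sigma(L)=g(n)$, whose syntactic monoid and syntactic semigroup are both isomorphic to $\mathcal S_n$. -/

import Mathlib

namespace JTrivial

/-! ### Green's relation J -/

/-- The principal two-sided ideal `M s M` of a monoid `M`. -/
def twoSidedIdeal {M : Type*} [Monoid M] (s : M) : Set M :=
  {x | ∃ a b : M, x = a * s * b}

/-- Green's relation `J`: `s J t` if and only if `M s M = M t M`. -/
def GreenJ {M : Type*} [Monoid M] (s t : M) : Prop :=
  twoSidedIdeal s = twoSidedIdeal t

/-- A monoid is `J`-trivial if `s J t` implies `s = t`. -/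
def IsJTrivial (M : Type*) [Monoid M] : Prop :=
  ∀ s t : M, GreenJ s t → s = t

/-! ### Languages -/

/-- The syntactic (Myhill) congruence of a language `L`, on the free monoid of all words:
`x ≈ y` iff for all words `u, v`, `u x v ∈ L ↔ u y v ∈ L`. -/
def syntacticCon {α : Type*} (L : Language α) : Con (FreeMonoid α) where
  r x y := ∀ u v : FreeMonoid α, (u * x * v).toList ∈ L ↔ (u * y * v).toList ∈ L
  iseqv :=
    { refl := fun _ _ _ => Iff.rfl
      symm := fun h u v => (h u v).symm
      trans := fun h₁ h₂ u v => (h₁ u v).trans (h₂ u v) }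
  mul' := by
    intro w x y z h₁ h₂ u v
    have e₁ := h₁ u (y * v)
    have e₂ := h₂ (u * x) v
    simp only [mul_assoc] at e₁ e₂ ⊢
    exact e₁.trans e₂

/-- The syntactic monoid of `L`: all words modulo the syntactic congruence. -/
abbrev SyntacticMonoid {α : Type*} (L : Language α) : Type _ :=
  (syntacticCon L).Quotient

/-- The syntactic congruence restricted to the free semigroup of all nonempty words. -/
def syntacticSemigroupCon {α : Type*} (L : Language α) : Con (FreeSemigroup α) :=
  (syntacticCon L).comap (FreeSemigroup.lift FreeMonoid.of) (map_mul _)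

/-- The syntactic semigroup of `L`: all nonempty words modulo the syntactic congruence. -/
abbrev SyntacticSemigroup {α : Type*} (L : Language α) : Type _ :=
  (syntacticSemigroupCon L).Quotient

/-- The syntactic complexity of `L`: the cardinality of its syntactic semigroup (which is finite
for a regular language). -/
noncomputable def syntacticComplexity {α : Type*} (L : Language α) : ℕ :=
  Nat.card (SyntacticSemigroup L)

/-- The quotient complexity of `L`: the number of distinct left quotients of `L` (which is finite
for a regular language). -/
noncomputable def quotientComplexity {α : Type*} (L : Language α) : ℕ :=
  (Set.range L.leftQuotient).ncard

/-- A language is `J`-trivial if its syntactic monoid is. -/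
def IsJTrivialLanguage {α : Type*} (L : Language α) : Prop :=
  IsJTrivial (SyntacticMonoid L)

/-! ### Transformations of an `n`-element chain

The chain `1 < 2 < ⋯ < n` is `Fin n` with `n ≠ 0`; its largest element is `⊤`. -/

/-- The monoid of all transformations of the chain, acting on the right: the product `t * s` is
"first `t`, then `s`". -/
abbrev Transf (n : ℕ) : Type := (Function.End (Fin n))ᵐᵒᵖ

/-- The image `i t` of `i` under `t`. -/
def Transf.app {n : ℕ} (t : Transf n) (i : Fin n) : Fin n := t.unop i

/-- The monoid of all non-decreasing transformations. -/
def nonDecreasing (n : ℕ) : Submonoid (Transf n) where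
  carrier := {t | ∀ p : Fin n, p ≤ t.app p}
  one_mem' := fun p => le_refl p
  mul_mem' := fun {a _} ha hb p => le_trans (ha p) (hb (a.app p))

/-- The orbit of `t` containing `i`: all `j` with `i t ^ k = j t ^ l` for some `k, l ≥ 0`. -/
def orbitOf {n : ℕ} (t : Transf n) (i : Fin n) : Set (Fin n) :=
  {j | ∃ k l : ℕ, (t ^ k).app i = (t ^ l).app j}

/-- The set of all orbits of `t`, a partition of the chain. -/
def orbits {n : ℕ} (t : Transf n) : Set (Set (Fin n)) :=
  Set.range (orbitOf t)

/-- All non-decreasing transformations whose set of orbits is `π`. -/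
def withOrbits {n : ℕ} (π : Set (Set (Fin n))) : Set (Transf n) :=
  {t | t ∈ nonDecreasing n ∧ orbits t = π}

/-- The partition `{{j₁}, …, {jᵣ}, Q \ {j₁, …, jᵣ}}` of `Q = {1, …, n}`, for a set
`Z = {j₁, …, jᵣ, n}` containing `n`. -/
def partitionOf {n : ℕ} [NeZero n] (Z : Finset (Fin n)) : Set (Set (Fin n)) :=
  insert {i | i ∉ Z ∨ i = ⊤} {X | ∃ j ∈ Z, j ≠ ⊤ ∧ X = {j}}

/-- The set `S_n` of all non-decreasing transformations whose set of orbits is the partition of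
some `Z` containing `n`. -/
def Sn (n : ℕ) [NeZero n] : Set (Transf n) :=
  {t | ∃ Z : Finset (Fin n), ⊤ ∈ Z ∧ t ∈ withOrbits (partitionOf Z)}

/-- The transformation `t_Z`: it fixes every element of `Z`, sends `h = max (Q \ Z)` to `n`, and
sends every other element to `h`. -/
def generatorOf {n : ℕ} [NeZero n] (Z : Finset (Fin n)) : Transf n :=
  MulOpposite.op fun i =>
    if hi : i ∈ Z then i
    else if i = Zᶜ.max' ⟨i, Finset.mem_compl.mpr hi⟩ then ⊤
    else Zᶜ.max' ⟨i, Finset.mem_compl.mpr hi⟩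

/-- The set of all `t_Z` for `Z` containing `n`. -/
def GSn (n : ℕ) [NeZero n] : Set (Transf n) :=
  {t | ∃ Z : Finset (Fin n), ⊤ ∈ Z ∧ t = generatorOf Z}

/-- `g(n) = ∑_{r=1}^{n} C(n-1, r-1) (n-r)!`. -/
def g (n : ℕ) : ℕ :=
  ∑ r ∈ Finset.Icc 1 n, (n - 1).choose (r - 1) * (n - r).factorial

end JTrivial

namespace JTrivial

/-! ### `J`-trivial monoids -/

/-! The upper bound comes from fixing the set `W` of moved points. In a finite `J`-trivial monoid
some power of `s * t` absorbs both `s` and `t`; this forces all elements moving exactly `W` to share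
one retraction `r` onto the complement of `W`, constant on their orbits (`exists_retraction`). In a
non-decreasing monoid a point `i ∈ W` therefore goes to `r i` or to a larger element of `W`, which
leaves at most `|W|!` elements. Since `⊤` is never moved, summing over the subsets of the other `n -
1` points gives `g n` (`card_le_g`). In `S_n` the retraction sends all of `W` to `⊤` and every
choice occurs, so equality holds.

For a language, words act on its `n` left quotients and the image of this action is the syntactic
monoid. `J`-triviality makes reachability a partial order; numbering the quotients along a linear
extension makes the action non-decreasing (`card_le_g_of_isJTrivial`).

For tightness, letters act as the generators `t_Z`, with `⊥` initial and `⊤` accepting. This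
automaton is minimal, and the identity is among the generators, so semigroup and monoid agree. That
the `t_Z` generate `S_n` is shown by building `t` from its largest image downwards. The closed form
compares `g n` with the truncated exponential series. -/

theorem GreenJ.of_factorizations {M : Type*} [Monoid M] {s t a b c d : M}
    (hs : s = a * t * b) (ht : t = c * s * d) : GreenJ s t := by
  apply Set.Subset.antisymm
  · rintro x ⟨p, q, rfl⟩
    exact ⟨p * a, b * q, by rw [hs]; simp only [mul_assoc]⟩
  · rintro x ⟨p, q, rfl⟩
    exact ⟨p * c, d * q, by rw [ht]; simp only [mul_assoc]⟩

theorem GreenJ.factorization {M : Type*} [Monoid M] {s t : M} (h : GreenJ s t) :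
    ∃ a b, s = a * t * b := by
  have hs : s ∈ twoSidedIdeal s := ⟨1, 1, by simp⟩
  rw [show twoSidedIdeal s = twoSidedIdeal t from h] at hs
  exact hs

theorem IsJTrivial.mul_eq_of_mul_mul_eq {M : Type*} [Monoid M] (hM : IsJTrivial M) {x s t : M}
    (h : x * s * t = x) : x * s = x :=
  hM _ _ (GreenJ.of_factorizations (a := 1) (b := s) (c := 1) (d := t) (by simp) (by simp [h]))

theorem IsJTrivial.mul_eq_of_mul_mul_eq' {M : Type*} [Monoid M] (hM : IsJTrivial M) {x s t : M}
    (h : s * (t * x) = x) : t * x = x :=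
  hM _ _ (GreenJ.of_factorizations (a := t) (b := 1) (c := s) (d := 1) (by simp) (by simp [h]))

theorem exists_pow_eq_pow_add_succ {M : Type*} [Monoid M] [Finite M] (z : M) :
    ∃ k m : ℕ, z ^ k = z ^ (k + (m + 1)) := by
  obtain ⟨i, j, hij, h⟩ := Finite.exists_ne_map_eq_of_infinite fun k : ℕ => z ^ k
  rcases lt_or_gt_of_ne hij with hlt | hlt
  · exact ⟨i, j - i - 1, by rw [show i + (j - i - 1 + 1) = j by omega]; exact h⟩
  · exact ⟨j, i - j - 1, by rw [show j + (i - j - 1 + 1) = i by omega]; exact h.symm⟩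

/-- In a finite `J`-trivial monoid some power of `s * t` absorbs `s` and `t` on both sides. -/
theorem IsJTrivial.exists_pow_absorbing {M : Type*} [Monoid M] [Finite M] (hM : IsJTrivial M)
    (s t : M) : ∃ k : ℕ, s * (s * t) ^ k = (s * t) ^ k ∧ t * (s * t) ^ k = (s * t) ^ k ∧
      (s * t) ^ k * s = (s * t) ^ k ∧ (s * t) ^ k * t = (s * t) ^ k := by
  -- Eventual periodicity makes `(s * t) ^ k` recoverable from its products with `s * t`, with `s`
  -- on the right and with `t` on the left; `J`-triviality collapses these products, and the other
  -- two identities follow.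
  obtain ⟨k, m, h⟩ := exists_pow_eq_pow_add_succ (s * t)
  have hr : (s * t) ^ k * (s * t) * (s * t) ^ m = (s * t) ^ k := by
    rw [mul_assoc, ← pow_succ', ← pow_add, ← h]
  have hl : (s * t) ^ m * ((s * t) * (s * t) ^ k) = (s * t) ^ k := by
    rw [← mul_assoc, ← pow_succ, ← pow_add, add_comm, ← h]
  have hr' : (s * t) ^ k * s = (s * t) ^ k :=
    hM.mul_eq_of_mul_mul_eq (t := t * (s * t) ^ m) (by simpa only [mul_assoc] using hr)
  have hl' := hM.mul_eq_of_mul_mul_eq' hl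
  have ht : t * (s * t) ^ k = (s * t) ^ k := hM.mul_eq_of_mul_mul_eq' (by rw [← mul_assoc, hl'])
  refine ⟨k, ?_, ht, hr', ?_⟩
  · rw [mul_assoc, ht] at hl'
    exact hl'
  · have := hM.mul_eq_of_mul_mul_eq hr
    rwa [← mul_assoc, hr'] at this

theorem IsJTrivial.of_mulEquiv {M N : Type*} [Monoid M] [Monoid N] (e : M ≃* N)
    (hM : IsJTrivial M) : IsJTrivial N := by
  intro s t h
  obtain ⟨a, b, hs⟩ := h.factorization
  obtain ⟨c, d, ht⟩ := GreenJ.factorization (s := t) (t := s) h.symm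
  apply e.symm.injective
  apply hM
  exact GreenJ.of_factorizations (a := e.symm a) (b := e.symm b) (c := e.symm c) (d := e.symm d)
    (by rw [← map_mul, ← map_mul, ← hs]) (by rw [← map_mul, ← map_mul, ← ht])

/-! ### Transformations -/

namespace Transf

variable {n : ℕ}

/-- A function as a transformation. -/
def ofFun (f : Fin n → Fin n) : Transf n := MulOpposite.op f

@[simp] theorem app_ofFun (f : Fin n → Fin n) (i : Fin n) : (ofFun f).app i = f i := rfl

@[simp] theorem app_one (i : Fin n) : app (1 : Transf n) i = i := rfl

@[simp] theorem app_mul (t s : Transf n) (i : Fin n) : (t * s).app i = s.app (t.app i) := rfl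

theorem ext_app {s t : Transf n} (h : ∀ i, s.app i = t.app i) : s = t :=
  MulOpposite.unop_injective (funext h)

theorem app_injective : Function.Injective (app : Transf n → Fin n → Fin n) :=
  fun _ _ h => ext_app (congrFun h)

instance : Finite (Transf n) := Finite.of_injective _ app_injective

theorem pow_app_of_app_eq {t : Transf n} {i : Fin n} (h : t.app i = i) (k : ℕ) :
    (t ^ k).app i = i := by
  induction k with
  | zero => rfl
  | succ k ih => rw [pow_succ, app_mul, ih, h]

/-- The set of points that `t` moves. -/
def support (t : Transf n) : Finset (Fin n) := {i | t.app i ≠ i}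

theorem mem_support {t : Transf n} {i : Fin n} : i ∈ t.support ↔ t.app i ≠ i := by
  simp [support]

theorem notMem_support {t : Transf n} {i : Fin n} : i ∉ t.support ↔ t.app i = i := by
  simp [support]

end Transf

theorem app_top {n : ℕ} [NeZero n] {t : Transf n} (ht : t ∈ nonDecreasing n) : t.app ⊤ = ⊤ :=
  top_le_iff.mp (ht ⊤)

/-! ### Counting -/

/-- Listed from the largest element of `W` downwards, the factors are `1, 2, …, |W|`. -/
theorem prod_card_filter_lt {β : Type*} [LinearOrder β] (W : Finset β) :
    ∏ i ∈ W, ((W.filter (i < ·)).card + 1) = W.card.factorial := by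
  induction W using Finset.induction_on_min with
  | empty => simp
  | insert a W ha ih =>
    have haW : a ∉ W := fun h => lt_irrefl _ (ha a h)
    rw [Finset.prod_insert haW, Finset.card_insert_of_notMem haW, Nat.factorial_succ, ← ih]
    congr 1
    · rw [Finset.filter_insert, if_neg (lt_irrefl a), Finset.filter_true_of_mem ha]
    · refine Finset.prod_congr rfl fun i hi => ?_
      rw [Finset.filter_insert, if_neg (ha i hi).not_gt]

/-- The functions that fix all points outside of `W` and send each `i ∈ W` to `r i` or to a
larger element of `W`. -/
def increasingOn {n : ℕ} (W : Finset (Fin n)) (r : Fin n → Fin n) : Finset (Fin n → Fin n) :=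
  Fintype.piFinset fun i => if i ∈ W then insert (r i) (W.filter (i < ·)) else {i}

theorem prod_ite_factorial {n : ℕ} (W : Finset (Fin n)) :
    ∏ i, (if i ∈ W then (W.filter (i < ·)).card + 1 else 1) = W.card.factorial := by
  rw [Finset.prod_ite_mem, Finset.univ_inter, prod_card_filter_lt]

theorem card_increasingOn_le {n : ℕ} (W : Finset (Fin n)) (r : Fin n → Fin n) :
    (increasingOn W r).card ≤ W.card.factorial := by
  rw [increasingOn, Fintype.card_piFinset, ← prod_ite_factorial]
  refine Finset.prod_le_prod' fun i _ => ?_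
  split_ifs
  · exact Finset.card_insert_le _ _
  · simp

theorem card_increasingOn_eq {n : ℕ} (W : Finset (Fin n)) (r : Fin n → Fin n)
    (hr : ∀ i, r i ∉ W) : (increasingOn W r).card = W.card.factorial := by
  rw [increasingOn, Fintype.card_piFinset, ← prod_ite_factorial]
  refine Finset.prod_congr rfl fun i _ => ?_
  split_ifs
  · exact Finset.card_insert_of_notMem fun h => hr i (Finset.mem_filter.mp h).1
  · simp

theorem mem_increasingOn {n : ℕ} {W : Finset (Fin n)} {r f : Fin n → Fin n} :
    f ∈ increasingOn W r ↔
      ∀ i, (i ∈ W → f i = r i ∨ f i ∈ W ∧ i < f i) ∧ (i ∉ W → f i = i) := by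
  rw [increasingOn, Fintype.mem_piFinset]
  refine forall_congr' fun i => ?_
  by_cases hi : i ∈ W <;> simp [hi]

/-- The subsets of size `m` account for the summand `r = n - m` of `g n`. -/
theorem sum_powerset_erase_top_factorial (n : ℕ) [NeZero n] :
    ∑ W ∈ (Finset.univ.erase (⊤ : Fin n)).powerset, W.card.factorial = g n := by
  rw [Finset.sum_powerset_apply_card, Finset.card_erase_of_mem (Finset.mem_univ _),
    Finset.card_univ, Fintype.card_fin, g]
  have hn := NeZero.pos n
  refine Finset.sum_nbij' (fun m => n - m) (fun r => n - r) ?_ ?_ ?_ ?_ ?_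
  · intro m hm; rw [Finset.mem_range] at hm; rw [Finset.mem_Icc]; omega
  · intro r hr; rw [Finset.mem_Icc] at hr; rw [Finset.mem_range]; omega
  · intro m hm; rw [Finset.mem_range] at hm; omega
  · intro r hr; rw [Finset.mem_Icc] at hr; omega
  · intro m hm
    rw [Finset.mem_range] at hm
    rw [smul_eq_mul, show n - (n - m) = m by omega, ← Nat.choose_symm (show m ≤ n - 1 by omega),
      show n - m - 1 = n - 1 - m by omega]

open Classical in
theorem card_eq_sum_support {n : ℕ} [NeZero n] (X : Set (Transf n)) (hX : X ⊆ nonDecreasing n) :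
    Nat.card X = ∑ W ∈ (Finset.univ.erase (⊤ : Fin n)).powerset,
      (Finset.univ.filter fun f : Fin n → Fin n =>
        Transf.ofFun f ∈ X ∧
          (Transf.ofFun f).support = W).card := by
  have e : X ≃ {f : Fin n → Fin n // Transf.ofFun f ∈ X} :=
    ⟨fun t => ⟨t.1.app, t.2⟩, fun f => ⟨_, f.2⟩, fun _ => rfl, fun _ => rfl⟩
  rw [Nat.card_congr e, Nat.card_eq_fintype_card, Fintype.card_subtype]
  rw [Finset.card_eq_sum_card_fiberwise
    (f := fun f : Fin n → Fin n => (Transf.ofFun f).support)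
    (t := (Finset.univ.erase (⊤ : Fin n)).powerset)]
  · simp only [Finset.filter_filter]
  · intro f hf
    simp only [Finset.coe_filter, Set.mem_ofPred_eq, Finset.mem_univ, true_and] at hf
    rw [Finset.mem_coe, Finset.mem_powerset]
    intro i hi
    rw [Finset.mem_erase]
    refine ⟨?_, Finset.mem_univ _⟩
    rintro rfl
    exact Transf.mem_support.mp hi (app_top (hX hf))

/-! ### The bound for monoids of non-decreasing transformations -/

theorem mul_app_eq_iff {n : ℕ} {s t : Transf n} (hs : s ∈ nonDecreasing n)
    (ht : t ∈ nonDecreasing n) {i : Fin n} :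
    (s * t).app i = i ↔ s.app i = i ∧ t.app i = i := by
  rw [Transf.app_mul]
  refine ⟨fun h => ?_, fun h => by rw [h.1, h.2]⟩
  have hsi : s.app i = i := le_antisymm ((ht _).trans_eq h) (hs i)
  exact ⟨hsi, by rwa [hsi] at h⟩

/-- The elements of a `J`-trivial monoid of transformations that move the same
points have a common retraction onto the fixed points, constant on all their orbits. -/
theorem exists_retraction {n : ℕ} {S : Submonoid (Transf n)} (hJ : IsJTrivial S) (W : Finset (Fin n)) :
    ∃ r : Fin n → Fin n, ∀ s ∈ S, s.support = W →
      (∀ i ∉ W, r i = i) ∧ ∀ i, r (s.app i) = r i := by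
  by_cases hW : ∃ s ∈ S, s.support = W
  swap
  · exact ⟨id, fun s hs hsW => absurd ⟨s, hs, hsW⟩ hW⟩
  obtain ⟨u, hu, huW⟩ := hW
  obtain ⟨k, -, -, hur, -⟩ := hJ.exists_pow_absorbing ⟨u, hu⟩ ⟨u, hu⟩
  generalize hx : ((⟨u, hu⟩ : S) * ⟨u, hu⟩) ^ k = x at hur
  -- The retraction is a stable power of one chosen `u` with support `W`; it remains to see that it
  -- does not depend on `u`, in the sense that every such `s` satisfies `s * x = x`.
  refine ⟨x.1.app, fun s hs hsW => ?_⟩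
  have hfixu : ∀ i ∉ W, u.app i = i := fun i hi => by
    rw [← huW] at hi; exact Transf.notMem_support.mp hi
  have hfixs : ∀ i ∉ W, s.app i = i := fun i hi => by
    rw [← hsW] at hi; exact Transf.notMem_support.mp hi
  have hfixx : ∀ i ∉ W, x.1.app i = i := fun i hi => by
    rw [← hx]
    exact Transf.pow_app_of_app_eq (t := u * u) (by simp [hfixu i hi]) k
  refine ⟨hfixx, ?_⟩
  have hxW : ∀ i, x.1.app i ∉ W := fun i => by
    rw [← huW, Transf.notMem_support]
    exact congrArg (fun y : S => y.1.app i) hur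
  obtain ⟨l, hsl, hul, -, -⟩ := hJ.exists_pow_absorbing ⟨s, hs⟩ ⟨u, hu⟩
  generalize hy : ((⟨s, hs⟩ : S) * ⟨u, hu⟩) ^ l = y at hsl hul
  have hfixy : ∀ i ∉ W, y.1.app i = i := fun i hi => by
    rw [← hy]
    exact Transf.pow_app_of_app_eq (t := s * u) (by simp [hfixu i hi, hfixs i hi]) l
  have hpow : ∀ m : ℕ, ((⟨u, hu⟩ : S) * ⟨u, hu⟩) ^ m * y = y := fun m => by
    induction m with
    | zero => simp
    | succ m ih => rw [pow_succ, mul_assoc, mul_assoc, hul, hul, ih]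
  -- The image of `x` avoids `W`, where `y` acts trivially, so also `x * y = x`. Hence `y = x`, and
  -- `x` inherits `s * y = y`.
  have hxy : x * y = y := by rw [← hx, hpow]
  have hyx : y = x := by
    apply Subtype.ext
    refine Transf.ext_app fun i => ?_
    have := congrArg (fun z : S => z.1.app i) hxy
    exact this.symm.trans (hfixy _ (hxW i))
  intro i
  rw [hyx] at hsl
  exact congrArg (fun z : S => z.1.app i) hsl

/-- If `i ∈ W` has its image outside `W`, that image is its own retract and hence equals `r i`;
otherwise `i` climbs strictly within `W`. So each fibre of the support lies in `increasingOn W r`.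
-/
theorem card_le_g {n : ℕ} [NeZero n] {S : Submonoid (Transf n)} (hS : S ≤ nonDecreasing n)
    (hJ : IsJTrivial S) : Nat.card S ≤ g n := by
  classical
  rw [← sum_powerset_erase_top_factorial]
  refine (card_eq_sum_support (S : Set (Transf n)) hS).trans_le ?_
  refine Finset.sum_le_sum fun W _ => ?_
  obtain ⟨r, hr⟩ := exists_retraction hJ W
  refine (Finset.card_le_card fun f hf => ?_).trans (card_increasingOn_le W r)
  obtain ⟨hfS, hfW⟩ := (Finset.mem_filter.mp hf).2
  obtain ⟨hfix, hconst⟩ := hr _ hfS hfW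
  rw [mem_increasingOn]
  intro i
  rw [← hfW, Transf.notMem_support]
  refine ⟨fun hi => ?_, id⟩
  by_cases hfi : f i ∈ W
  · refine Or.inr ⟨hfW.symm ▸ hfi, lt_of_le_of_ne (hS hfS i) ?_⟩
    exact (Transf.mem_support.mp hi).symm
  · left
    rw [← hfix _ hfi]
    exact hconst i

/-! ### The monoid `S_n` -/

section Sn

variable {n : ℕ}

theorem mem_orbitOf_of_pow {t : Transf n} {i j : Fin n} {k : ℕ} (h : (t ^ k).app i = j) :
    j ∈ orbitOf t i := ⟨k, 0, h⟩

theorem mem_orbitOf_self (t : Transf n) (i : Fin n) : i ∈ orbitOf t i := ⟨0, 0, rfl⟩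

theorem exists_max_notMem {Z : Finset (Fin n)} (hZ : Z ≠ Finset.univ) :
    ∃ h ∉ Z, ∀ i ∉ Z, i ≤ h := by
  have hne : Zᶜ.Nonempty := by
    rwa [Finset.nonempty_iff_ne_empty, Ne, Finset.compl_eq_empty_iff]
  exact ⟨Zᶜ.max' hne, Finset.mem_compl.mp (Zᶜ.max'_mem hne),
    fun i hi => Finset.le_max' _ _ (Finset.mem_compl.mpr hi)⟩

/-- The transformation that acts as `t` on the points with an image in the upper set of `v`, and
trivially elsewhere. -/
noncomputable def restrictImage (t : Transf n) (v : ℕ) : Transf n :=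
  Transf.ofFun fun i => if v ≤ (t.app i : ℕ) then t.app i else i

theorem restrictImage_app (t : Transf n) (v : ℕ) (i : Fin n) :
    (restrictImage t v).app i = if v ≤ (t.app i : ℕ) then t.app i else i := rfl

theorem restrictImage_eq_of_forall_ne {t : Transf n} {v : Fin n}
    (hv : ∀ i, t.app i = v → i = v) : restrictImage t v = restrictImage t (v + 1) := by
  refine Transf.ext_app fun i => ?_
  rw [restrictImage_app, restrictImage_app]
  by_cases hi : t.app i = v
  · rw [if_pos (by rw [hi]), if_neg (by rw [hi]; omega), hi, hv i hi]
  · have hi' : (t.app i : ℕ) ≠ v := fun h => hi (Fin.ext h)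
    exact if_congr (by omega) rfl rfl

variable [NeZero n]

/-- No point other than the fixed points and `⊤` is the image of a moved point. -/
def OnlyTopAbsorbs (t : Transf n) : Prop :=
  ∀ i, t.app (t.app i) = t.app i → t.app i = i ∨ t.app i = ⊤

theorem OnlyTopAbsorbs.eq_of_pow_app_eq {t : Transf n} (h : OnlyTopAbsorbs t) {j : Fin n}
    (hj : t.app j = j) (hjt : j ≠ ⊤) {k : ℕ} {i : Fin n} (hk : (t ^ k).app i = j) : i = j := by
  induction k generalizing i with
  | zero => exact hk
  | succ k ih =>
    rw [pow_succ', Transf.app_mul] at hk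
    have hi := ih hk
    rcases h i (by rw [hi, hj]) with h' | h'
    · exact h'.symm.trans hi
    · exact absurd (hi.symm.trans h') hjt

/-- A moved point climbs strictly, and the only fixed point it can run into is `⊤`. -/
theorem OnlyTopAbsorbs.exists_pow_app_eq_top {t : Transf n} (h : OnlyTopAbsorbs t)
    (ht : t ∈ nonDecreasing n) (i : Fin n) (hi : t.app i ≠ i ∨ i = ⊤) :
    ∃ k : ℕ, (t ^ k).app i = ⊤ := by
  induction i using WellFoundedGT.induction with
  | _ i ih =>
    rcases hi with hi | rfl
    swap
    · exact ⟨0, rfl⟩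
    have hlt : i < t.app i := lt_of_le_of_ne (ht i) (Ne.symm hi)
    have hne : t.app (t.app i) ≠ t.app i ∨ t.app i = ⊤ := by
      by_cases hc : t.app (t.app i) = t.app i
      · exact Or.inr ((h i hc).resolve_left hi)
      · exact Or.inl hc
    obtain ⟨k, hk⟩ := ih (t.app i) hlt hne
    exact ⟨k + 1, by rw [pow_succ', Transf.app_mul, hk]⟩

/-- Under a non-decreasing map every orbit ends in exactly one fixed point. The orbit partition is
`partitionOf Z` precisely when all fixed points below `⊤` are isolated, and `Z` is then the set of
fixed points. -/
theorem mem_Sn_iff {t : Transf n} : t ∈ Sn n ↔ t ∈ nonDecreasing n ∧ OnlyTopAbsorbs t := by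
  constructor
  · rintro ⟨Z, -, ht, hZ⟩
    refine ⟨ht, fun i hi => ?_⟩
    have hti : t.app i ∈ orbitOf t i := mem_orbitOf_of_pow (k := 1) (by rw [pow_one])
    have hO : orbitOf t i ∈ partitionOf Z := hZ ▸ Set.mem_range_self i
    rcases hO with hO | ⟨m, -, -, hO⟩
    · right
      have htop : (⊤ : Fin n) ∈ orbitOf t i := by rw [hO]; exact Or.inr rfl
      obtain ⟨k, l, hkl⟩ := htop
      rw [Transf.pow_app_of_app_eq (app_top ht)] at hkl
      -- Since `t i` is fixed, `t ^ (k + 1)` sends `i` to `t i`; it also sends `i` to `⊤`.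
      have h := app_top ht
      rw [← hkl, ← Transf.app_mul, ← pow_succ, pow_succ', Transf.app_mul,
        Transf.pow_app_of_app_eq hi] at h
      rw [h, hkl]
    · left
      have hi' := mem_orbitOf_self t i
      rw [hO] at hti hi'
      exact Eq.trans hti (Eq.symm hi')
  · rintro ⟨ht, h⟩
    have hfixed : ∀ i, t.app i = i → i ≠ ⊤ → orbitOf t i = {i} := by
      intro i hi hit
      ext y
      constructor
      · rintro ⟨k, l, hkl⟩
        rw [Transf.pow_app_of_app_eq hi] at hkl
        exact h.eq_of_pow_app_eq hi hit hkl.symm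
      · rintro rfl
        exact mem_orbitOf_self t _
    have hmoved : ∀ i, t.app i ≠ i ∨ i = ⊤ →
        orbitOf t i = {j | j ∉ t.supportᶜ ∨ j = ⊤} := by
      intro i hi
      ext y
      simp only [Finset.mem_compl, not_not, Transf.mem_support, Set.mem_ofPred_eq]
      obtain ⟨a, ha⟩ := h.exists_pow_app_eq_top ht i hi
      constructor
      · rintro ⟨k, l, hkl⟩
        by_contra! hy
        rw [Transf.pow_app_of_app_eq hy.1] at hkl
        have hiy := h.eq_of_pow_app_eq hy.1 hy.2 hkl
        subst hiy
        rcases hi with hi | hi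
        · exact hi hy.1
        · exact hy.2 hi
      · intro hy
        obtain ⟨b, hb⟩ := h.exists_pow_app_eq_top ht y hy
        exact ⟨a, b, ha.trans hb.symm⟩
    refine ⟨t.supportᶜ, ?_, ht, ?_⟩
    · rw [Finset.mem_compl, Transf.notMem_support]
      exact app_top ht
    · ext X
      constructor
      · rintro ⟨i, rfl⟩
        by_cases hi : t.app i ≠ i ∨ i = ⊤
        · exact Or.inl (hmoved i hi)
        · push Not at hi
          refine Or.inr ⟨i, ?_, hi.2, hfixed i hi.1 hi.2⟩
          rw [Finset.mem_compl, Transf.notMem_support]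
          exact hi.1
      · rintro (rfl | ⟨j, hj, hjt, rfl⟩)
        · exact ⟨⊤, hmoved ⊤ (Or.inr rfl)⟩
        · rw [Finset.mem_compl, Transf.notMem_support] at hj
          exact ⟨j, hfixed j hj hjt⟩

/-- `S_n` as a submonoid. -/
def SnSubmonoid (n : ℕ) [NeZero n] : Submonoid (Transf n) where
  carrier := Sn n
  one_mem' := mem_Sn_iff.mpr ⟨one_mem _, fun _ _ => Or.inl rfl⟩
  mul_mem' := by
    intro s t hs ht
    rw [mem_Sn_iff] at hs ht ⊢
    refine ⟨mul_mem hs.1 ht.1, fun i hi => ?_⟩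
    by_cases htop : (s * t).app i = ⊤
    · exact Or.inr htop
    left
    rw [mul_app_eq_iff hs.1 ht.1] at hi
    rw [Transf.app_mul] at hi htop ⊢
    have hsi : t.app (s.app i) = s.app i := (ht.2 _ hi.2).resolve_right htop
    rw [hsi] at hi htop ⊢
    exact (hs.2 _ hi.1).resolve_right htop

theorem mem_SnSubmonoid {t : Transf n} :
    t ∈ SnSubmonoid n ↔ t ∈ nonDecreasing n ∧ OnlyTopAbsorbs t := mem_Sn_iff

theorem SnSubmonoid_le : SnSubmonoid n ≤ nonDecreasing n := fun _ h => (mem_Sn_iff.mp h).1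

/-- From `s = a t b` and `t = c s d` follows `s = (a c) ^ k s (d b) ^ k` for all `k`. If `a c` moves
`i`, a power of it takes `i` to `⊤`, so `s` does too; by symmetry so does `t`. If `a` and `c` both
fix `i`, the two factorizations give inequalities in both directions. -/
theorem isJTrivial_SnSubmonoid : IsJTrivial (SnSubmonoid n) := by
  have key : ∀ {s t a b c d : SnSubmonoid n}, s = a * t * b → t = c * s * d → ∀ i,
      (a * c).1.app i ≠ i → s.1.app i = ⊤ := by
    intro s t a b c d hs ht i hi
    have hpow : ∀ k : ℕ, s = (a * c) ^ k * s * (d * b) ^ k := by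
      intro k
      induction k with
      | zero => simp
      | succ k ih =>
        calc s = a * (c * s * d) * b := by rw [← ht, ← hs]
          _ = (a * c) * s * (d * b) := by simp only [mul_assoc]
          _ = (a * c) * ((a * c) ^ k * s * (d * b) ^ k) * (d * b) := by rw [← ih]
          _ = _ := by rw [pow_succ', pow_succ]; simp only [mul_assoc]
    have hac := mem_SnSubmonoid.mp (a * c).2
    obtain ⟨k, hk⟩ := hac.2.exists_pow_app_eq_top hac.1 i (Or.inl hi)
    rw [hpow k]
    change (((d * b) ^ k : SnSubmonoid n) : Transf n).app (s.1.app (((a * c).1 ^ k).app i)) = ⊤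
    rw [hk, app_top (SnSubmonoid_le s.2), app_top (SnSubmonoid_le ((d * b) ^ k).2)]
  intro s t h
  obtain ⟨a, b, hs⟩ := h.factorization
  obtain ⟨c, d, ht⟩ := GreenJ.factorization (s := t) (t := s) h.symm
  apply Subtype.ext
  refine Transf.ext_app fun i => ?_
  by_cases hac : a.1.app i = i ∧ c.1.app i = i
  · apply le_antisymm
    · conv_rhs => rw [ht]
      change _ ≤ d.1.app (s.1.app (c.1.app i))
      rw [hac.2]
      exact SnSubmonoid_le d.2 _
    · conv_rhs => rw [hs]
      change _ ≤ b.1.app (t.1.app (a.1.app i))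
      rw [hac.1]
      exact SnSubmonoid_le b.2 _
  · rw [key hs ht i, key ht hs i]
    · intro h'
      exact hac ((mul_app_eq_iff (SnSubmonoid_le c.2) (SnSubmonoid_le a.2)).mp h').symm
    · intro h'
      exact hac ((mul_app_eq_iff (SnSubmonoid_le a.2) (SnSubmonoid_le c.2)).mp h')

/-- The bound is attained for each support `W`: with the constant retraction `⊤ ∉ W`, membership in
`S_n` is the same as membership in `increasingOn W`. -/
theorem card_SnSubmonoid : Nat.card (SnSubmonoid n) = g n := by
  classical
  rw [← sum_powerset_erase_top_factorial]
  refine (card_eq_sum_support (SnSubmonoid n : Set (Transf n)) SnSubmonoid_le).trans ?_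
  refine Finset.sum_congr rfl fun W hW => ?_
  have htop : ⊤ ∉ W := fun h => Finset.notMem_erase _ _ (Finset.mem_powerset.mp hW h)
  rw [← card_increasingOn_eq W (fun _ => ⊤) fun _ => htop]
  congr 1
  ext f
  rw [Finset.mem_filter, mem_increasingOn]
  change _ ∧ Transf.ofFun f ∈ SnSubmonoid n ∧ _ ↔ _
  rw [mem_SnSubmonoid]
  constructor
  · rintro ⟨-, ⟨hf, hS⟩, hfW⟩ i
    rw [← hfW, Transf.notMem_support, Transf.mem_support, Transf.mem_support]
    refine ⟨fun hi => ?_, id⟩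
    by_cases hc : f (f i) = f i
    · exact Or.inl ((hS i hc).resolve_left hi)
    · exact Or.inr ⟨hc, lt_of_le_of_ne (hf i) (Ne.symm hi)⟩
  · intro h
    have hsupp : (Transf.ofFun f).support = W := by
      ext i
      rw [Transf.mem_support, Transf.app_ofFun]
      refine ⟨fun hi => by_contra fun hiW => hi ((h i).2 hiW), fun hi => ?_⟩
      rcases (h i).1 hi with h' | h'
      · rw [h']
        rintro rfl
        exact htop hi
      · exact h'.2.ne'
    refine ⟨Finset.mem_univ _, ⟨fun i => ?_, fun i hi => ?_⟩, hsupp⟩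
    · by_cases hi : i ∈ W
      · rcases (h i).1 hi with h' | h'
        · exact le_top.trans_eq h'.symm
        · exact h'.2.le
      · exact ((h i).2 hi).ge
    · by_cases hiW : i ∈ W
      · rcases (h i).1 hiW with h' | h'
        · exact Or.inr h'
        · rw [← hsupp, Transf.mem_support] at h'
          exact absurd hi h'.1
      · exact Or.inl ((h i).2 hiW)

/-! ### The generators of `S_n` -/

/-- `t_Z` in terms of the complement of `Z` and its largest element. -/
theorem generatorOf_app {Z : Finset (Fin n)} {h : Fin n} (hh : h ∉ Z)
    (hmax : ∀ i ∉ Z, i ≤ h) (i : Fin n) :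
    (generatorOf Z).app i = if i ∈ Z then i else if i = h then ⊤ else h := by
  have hm : ∀ hne : Zᶜ.Nonempty, Zᶜ.max' hne = h := fun hne =>
    le_antisymm (hmax _ (Finset.mem_compl.mp (Zᶜ.max'_mem hne)))
      (Finset.le_max' _ _ (Finset.mem_compl.mpr hh))
  by_cases hi : i ∈ Z
  · rw [if_pos hi]
    exact dif_pos hi
  · rw [if_neg hi, ← hm ⟨i, Finset.mem_compl.mpr hi⟩]
    exact dif_neg hi

theorem generatorOf_univ : generatorOf (Finset.univ : Finset (Fin n)) = 1 :=
  Transf.ext_app fun i => dif_pos (Finset.mem_univ i)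

theorem support_generatorOf {Z : Finset (Fin n)} (hZ : ⊤ ∈ Z) :
    (generatorOf Z).support = Zᶜ := by
  ext i
  rw [Transf.mem_support, Finset.mem_compl]
  by_cases hu : Z = Finset.univ
  · rw [hu, generatorOf_univ]; simp
  obtain ⟨h, hh, hmax⟩ := exists_max_notMem hu
  rw [generatorOf_app hh hmax]
  by_cases hi : i ∈ Z
  · simp [hi]
  · rw [if_neg hi]
    split_ifs with hih
    · subst hih
      refine ⟨fun _ => hi, fun _ h' => hi (h' ▸ hZ)⟩
    · exact ⟨fun _ => hi, fun _ => Ne.symm hih⟩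

theorem generatorOf_mem {Z : Finset (Fin n)} (hZ : ⊤ ∈ Z) : generatorOf Z ∈ SnSubmonoid n := by
  by_cases hu : Z = Finset.univ
  · rw [hu, generatorOf_univ]; exact one_mem _
  obtain ⟨h, hh, hmax⟩ := exists_max_notMem hu
  rw [mem_SnSubmonoid]
  refine ⟨fun i => ?_, fun i hi => ?_⟩
  · rw [generatorOf_app hh hmax]
    split_ifs with h1 h2
    · exact le_rfl
    · exact le_top
    · exact hmax i h1
  · have hm : (generatorOf Z).app i ∉ (generatorOf Z).support := Transf.notMem_support.mpr hi
    rw [support_generatorOf hZ, Finset.mem_compl, not_not] at hm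
    rw [generatorOf_app hh hmax] at hm ⊢
    split_ifs at hm ⊢ with h1 h2
    · exact Or.inl rfl
    · exact Or.inr rfl
    · exact absurd hm hh

theorem ncard_GSn : (GSn n).ncard = 2 ^ (n - 1) := by
  have hGS : GSn n = (fun W : Finset (Fin n) => generatorOf Wᶜ) ''
      ((Finset.univ.erase (⊤ : Fin n)).powerset : Set (Finset (Fin n))) := by
    ext t
    constructor
    · rintro ⟨Z, hZ, rfl⟩
      refine ⟨Zᶜ, ?_, by simp⟩
      rw [Finset.mem_coe, Finset.mem_powerset]
      intro i hi
      rw [Finset.mem_compl] at hi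
      exact Finset.mem_erase.mpr ⟨fun h => hi (h ▸ hZ), Finset.mem_univ _⟩
    · rintro ⟨W, hW, rfl⟩
      rw [Finset.mem_coe, Finset.mem_powerset] at hW
      exact ⟨Wᶜ, Finset.mem_compl.mpr fun h => Finset.notMem_erase _ _ (hW h), rfl⟩
  rw [hGS, Set.InjOn.ncard_image, Set.ncard_coe_finset, Finset.card_powerset,
    Finset.card_erase_of_mem (Finset.mem_univ _), Finset.card_univ, Fintype.card_fin]
  intro V hV W hW hVW
  rw [Finset.mem_coe, Finset.mem_powerset] at hV hW
  have h := congrArg Transf.support hVW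
  dsimp only at h
  rwa [support_generatorOf, support_generatorOf, compl_compl, compl_compl] at h
  · exact Finset.mem_compl.mpr fun h => Finset.notMem_erase _ _ (hW h)
  · exact Finset.mem_compl.mpr fun h => Finset.notMem_erase _ _ (hV h)

theorem sendToTop_mem_closure (A : Finset (Fin n)) :
    Transf.ofFun (fun i => if i ∈ A then ⊤ else i) ∈ Submonoid.closure (GSn n) := by
  induction A using Finset.induction_on with
  | empty => exact one_mem _
  | insert a A ha ih =>
    by_cases hat : a = ⊤
    · convert ih using 2
      funext i
      by_cases hi : i = a
      · simp [hi, hat]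
      · simp [hi]
    have hgen : generatorOf ({a}ᶜ : Finset (Fin n)) ∈ Submonoid.closure (GSn n) :=
      Submonoid.subset_closure ⟨_, by simpa using Ne.symm hat, rfl⟩
    convert mul_mem ih hgen using 1
    refine Transf.ext_app fun i => ?_
    rw [Transf.app_mul, generatorOf_app (h := a) (by simp) (by simp)]
    simp only [Transf.app_ofFun, Finset.mem_insert, Finset.mem_compl, Finset.mem_singleton]
    by_cases hi : i ∈ A
    · simp [hi, Ne.symm hat]
    · by_cases hia : i = a <;> simp [hi, hia, ha]

/-- The complement of this `Z` consists of `v` and its preimages, all below `v`. The first factor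
has already taken `v` higher, so the only effect of `t_Z` is to send the preimages, still in place,
to `v`. -/
theorem restrictImage_eq_mul_generatorOf {t : Transf n} (ht : t ∈ nonDecreasing n) {v : Fin n}
    (hv : v < t.app v) :
    restrictImage t v = restrictImage t (v + 1) *
      generatorOf (Finset.univ.filter fun i => t.app i ≠ v ∧ i ≠ v) := by
  have hle : ∀ i, t.app i = v → i < v := fun i hi =>
    lt_of_le_of_ne ((ht i).trans_eq hi) fun h => by rw [h] at hi; exact hv.ne' hi
  have hgen := fun i => generatorOf_app
    (Z := Finset.univ.filter fun i => t.app i ≠ v ∧ i ≠ v) (h := v) (by simp)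
    (fun i hi => by
      by_contra hlt
      rw [not_le] at hlt
      refine hi (Finset.mem_filter.mpr ⟨Finset.mem_univ _, fun h => ?_, hlt.ne'⟩)
      exact (hle i h).asymm hlt) i
  refine Transf.ext_app fun i => ?_
  rw [Transf.app_mul, hgen, restrictImage_app, restrictImage_app]
  simp only [Finset.mem_filter, Finset.mem_univ, true_and]
  rcases lt_trichotomy (t.app i) v with hi | hi | hi
  · have h1 : ¬ ((v : ℕ) ≤ (t.app i : ℕ)) := by rwa [not_le, Fin.val_fin_lt]
    have h2 : ¬ ((v : ℕ) + 1 ≤ (t.app i : ℕ)) := by omega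
    have h3 : i ≠ v := by
      rintro rfl
      exact hi.asymm hv
    rw [if_neg h1, if_neg h2, if_pos ⟨hi.ne, h3⟩]
  · have h2 : ¬ ((v : ℕ) + 1 ≤ (t.app i : ℕ)) := by rw [hi]; omega
    rw [if_pos (by rw [hi]), if_neg h2, if_neg (fun h => h.1 hi), if_neg (hle i hi).ne, hi]
  · have h1 : (v : ℕ) + 1 ≤ (t.app i : ℕ) := hi
    have h2 : t.app (t.app i) ≠ v := fun h => (hi.trans (hle _ h)).false
    rw [if_pos (by omega), if_pos h1, if_pos ⟨h2, hi.ne'⟩]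

/-- Downward induction on the threshold `v`. A level hit by no point other than `v` changes nothing.
If another point has image `v ≠ ⊤`, then `v` is not fixed, and one more generator suffices. -/
theorem restrictImage_mem_closure {t : Transf n} (ht : t ∈ SnSubmonoid n) (k v : ℕ)
    (hk : v + k = n - 1) : restrictImage t v ∈ Submonoid.closure (GSn n) := by
  have hn := NeZero.pos n
  have htop : ((⊤ : Fin n) : ℕ) = n - 1 := rfl
  rw [mem_SnSubmonoid] at ht
  induction k generalizing v with
  | zero =>
    convert sendToTop_mem_closure (Finset.univ.filter fun i => t.app i = ⊤) using 1
    refine Transf.ext_app fun i => ?_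
    rw [restrictImage_app, Transf.app_ofFun]
    simp only [Finset.mem_filter, Finset.mem_univ, true_and]
    by_cases hi : t.app i = ⊤
    · rw [if_pos hi, if_pos (by rw [hi, htop]; omega), hi]
    · rw [if_neg hi, if_neg fun h => hi (Fin.ext ?_)]
      have := (t.app i).isLt
      omega
  | succ k ih =>
    have hmem := ih (v + 1) (by omega)
    obtain ⟨w, rfl⟩ : ∃ w : Fin n, (w : ℕ) = v := ⟨⟨v, by omega⟩, rfl⟩
    by_cases hw : ∀ i, t.app i = w → i = w
    · rwa [restrictImage_eq_of_forall_ne hw]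
    push Not at hw
    obtain ⟨j, hj, hjw⟩ := hw
    have hwt : w ≠ ⊤ := fun h => by rw [← h] at htop; omega
    have hlt : w < t.app w := by
      refine lt_of_le_of_ne (ht.1 w) fun h => ?_
      rcases ht.2 j (by rw [hj]; exact h.symm) with h' | h'
      · exact hjw (h'.symm.trans hj)
      · exact hwt (hj.symm.trans h')
    rw [restrictImage_eq_mul_generatorOf ht.1 hlt]
    refine mul_mem hmem (Submonoid.subset_closure ⟨_, ?_, rfl⟩)
    rw [Finset.mem_filter, app_top ht.1]
    exact ⟨Finset.mem_univ _, hwt.symm, hwt.symm⟩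

theorem closure_GSn : Submonoid.closure (GSn n) = SnSubmonoid n := by
  apply le_antisymm
  · rw [Submonoid.closure_le]
    rintro t ⟨Z, hZ, rfl⟩
    exact generatorOf_mem hZ
  · intro t ht
    have h := restrictImage_mem_closure ht (n - 1) 0 (by omega)
    convert h using 1
    exact Transf.ext_app fun i => by rw [restrictImage_app, if_pos (Nat.zero_le _)]

end Sn

/-! ### The closed form of the bound -/

theorem g_eq_factorial_mul_sum {n : ℕ} (hn : 1 ≤ n) :
    (g n : ℝ) = ((n - 1).factorial : ℝ) * ∑ k ∈ Finset.range n, (1 : ℝ) ^ k / k.factorial := by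
  rw [g, Nat.cast_sum, Finset.mul_sum]
  refine Finset.sum_nbij' (fun r => r - 1) (fun k => k + 1) ?_ ?_ ?_ ?_ ?_
  · intro r hr; rw [Finset.mem_Icc] at hr; rw [Finset.mem_range]; omega
  · intro k hk; rw [Finset.mem_range] at hk; rw [Finset.mem_Icc]; omega
  · intro r hr; rw [Finset.mem_Icc] at hr; omega
  · intro k hk; omega
  · intro r hr
    rw [Finset.mem_Icc] at hr
    rw [one_pow, mul_one_div, eq_div_iff (by positivity),
      ← Nat.choose_mul_factorial_mul_factorial (show r - 1 ≤ n - 1 by omega),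
      show n - 1 - (r - 1) = n - r by omega]
    push_cast
    ring

/-- After scaling by `(n - 1)!`, the remainder estimate for the exponential series is `(n + 1) / n ^
2`, which is below `1` exactly from `n = 2` on. -/
theorem g_eq_floor {n : ℕ} (hn : 2 ≤ n) :
    g n = ⌊Real.exp 1 * ((n - 1).factorial : ℝ)⌋₊ := by
  symm
  rw [Nat.floor_eq_iff (by positivity), g_eq_factorial_mul_sum (by omega)]
  have hpos : (0 : ℝ) < ((n - 1).factorial : ℝ) := by positivity
  constructor
  · rw [mul_comm]
    exact mul_le_mul_of_nonneg_right (Real.sum_le_exp_of_nonneg zero_le_one n) hpos.le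
  · have h := Real.exp_bound' zero_le_one le_rfl (show 0 < n by omega)
    have hsmall : ((n - 1).factorial : ℝ) * ((1 : ℝ) ^ n * (n + 1) / (n.factorial * n)) < 1 := by
      obtain ⟨m, rfl⟩ : ∃ m, n = m + 2 := ⟨n - 2, by omega⟩
      rw [show m + 2 - 1 = m + 1 by omega, Nat.factorial_succ (m + 1), one_pow, one_mul,
        ← mul_div_assoc, div_lt_one (by positivity)]
      have : (0 : ℝ) < ((m + 1).factorial : ℝ) := by positivity
      push_cast
      rw [mul_comm ((m : ℝ) + 1 + 1), mul_assoc]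
      refine mul_lt_mul_of_pos_left ?_ this
      nlinarith [(Nat.cast_nonneg m : (0 : ℝ) ≤ m)]
    have h' := mul_le_mul_of_nonneg_left h hpos.le
    rw [mul_add] at h'
    rw [mul_comm (Real.exp 1)]
    linarith

theorem g_le_floor {n : ℕ} (hn : 1 ≤ n) :
    g n ≤ ⌊Real.exp 1 * ((n - 1).factorial : ℝ)⌋₊ := by
  rw [Nat.le_floor_iff (by positivity), g_eq_factorial_mul_sum hn, mul_comm]
  exact mul_le_mul_of_nonneg_right (Real.sum_le_exp_of_nonneg zero_le_one n) (by positivity)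

/-! ### The bound for transformation monoids without a given order -/

theorem exists_equiv_fin_monotone {β : Type*} [Fintype β] {n : ℕ} (h : Fintype.card β = n)
    (r : β → β → Prop) (hrefl : ∀ i, r i i) (htrans : ∀ i j k, r i j → r j k → r i k)
    (hantisymm : ∀ i j, r i j → r j i → i = j) :
    ∃ σ : β ≃ Fin n, ∀ i j, r i j → σ i ≤ σ j := by
  let _ : PartialOrder β :=
    { le := r, le_refl := hrefl, le_trans := htrans, le_antisymm := hantisymm }
  let _ : Fintype (LinearExtension β) := inferInstanceAs (Fintype β)
  let e : Fin n ≃o LinearExtension β := monoEquivOfFin (LinearExtension β) h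
  exact ⟨e.symm.toEquiv, fun i j hij => e.symm.monotone (toLinearExtension.monotone hij)⟩

/-- Conjugation by a permutation. -/
def Transf.conj {n : ℕ} (σ : Fin n ≃ Fin n) : Transf n ≃* Transf n where
  toFun t := Transf.ofFun fun i => σ (t.app (σ.symm i))
  invFun t := Transf.ofFun fun i => σ.symm (t.app (σ i))
  left_inv t := Transf.ext_app fun i => by simp
  right_inv t := Transf.ext_app fun i => by simp
  map_mul' s t := Transf.ext_app fun i => by simp

/-- Reachability under a `J`-trivial transformation monoid is antisymmetric. -/
theorem IsJTrivial.app_eq_self_of_app_app_eq {n : ℕ} {T : Submonoid (Transf n)}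
    (hT : IsJTrivial T) {t u : Transf n} (ht : t ∈ T) (hu : u ∈ T) {i : Fin n}
    (hi : u.app (t.app i) = i) : t.app i = i := by
  obtain ⟨k, -, -, h, -⟩ := hT.exists_pow_absorbing ⟨t, ht⟩ ⟨u, hu⟩
  have h' : t.app (((t * u) ^ k).app i) = ((t * u) ^ k).app i :=
    congrArg (fun x : T => x.1.app i) h
  rwa [Transf.pow_app_of_app_eq (t := t * u) hi] at h'

/-- Reachability is a partial order here; conjugating by a linear extension of it makes every
transformation non-decreasing. -/
theorem card_le_g_of_isJTrivial {n : ℕ} [NeZero n] {T : Submonoid (Transf n)}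
    (hT : IsJTrivial T) : Nat.card T ≤ g n := by
  obtain ⟨σ, hσ⟩ := exists_equiv_fin_monotone (Fintype.card_fin n)
    (fun i j => ∃ t ∈ T, t.app i = j) (fun i => ⟨1, one_mem T, rfl⟩)
    (by
      rintro i j k ⟨t, ht, rfl⟩ ⟨u, hu, rfl⟩
      exact ⟨t * u, mul_mem ht hu, rfl⟩)
    (by
      rintro i j ⟨t, ht, rfl⟩ ⟨u, hu, hi⟩
      exact (hT.app_eq_self_of_app_app_eq ht hu hi).symm)
  let e : T ≃* T.map (Transf.conj σ).toMonoidHom := (Transf.conj σ).submonoidMap T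
  rw [Nat.card_congr e.toEquiv]
  refine card_le_g ?_ (hT.of_mulEquiv e)
  rintro - ⟨t, ht, rfl⟩ p
  have h := hσ (σ.symm p) (t.app (σ.symm p)) ⟨t, ht, rfl⟩
  rwa [Equiv.apply_symm_apply] at h

/-! ### Syntactic semigroups and syntactic monoids -/

section Syntactic

variable {α : Type*}

/-- The canonical map from the syntactic semigroup to the syntactic monoid. -/
def SyntacticSemigroup.toMonoid (L : Language α) : SyntacticSemigroup L →ₙ* SyntacticMonoid L where
  toFun x := Con.liftOn x
    (fun w => ((FreeSemigroup.lift FreeMonoid.of w : FreeMonoid α) : SyntacticMonoid L))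
    fun _ _ h => (Con.eq _).mpr h
  map_mul' x y := by
    induction x using Con.induction_on with | _ x =>
    induction y using Con.induction_on with | _ y =>
    change ((FreeSemigroup.lift FreeMonoid.of (x * y) : FreeMonoid α) : SyntacticMonoid L) = _
    rw [map_mul, Con.coe_mul]
    rfl

theorem SyntacticSemigroup.toMonoid_coe (L : Language α) (w : FreeSemigroup α) :
    toMonoid L (w : SyntacticSemigroup L) =
      ((FreeSemigroup.lift FreeMonoid.of w : FreeMonoid α) : SyntacticMonoid L) := rfl

theorem SyntacticSemigroup.toMonoid_injective (L : Language α) :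
    Function.Injective (toMonoid L) := by
  intro x y h
  induction x using Con.induction_on with | _ x =>
  induction y using Con.induction_on with | _ y =>
  rw [toMonoid_coe, toMonoid_coe, Con.eq] at h
  exact (Con.eq _).mpr h

theorem exists_freeSemigroup_lift_eq (w : FreeMonoid α) (a : α) :
    ∃ z : FreeSemigroup α, FreeSemigroup.lift FreeMonoid.of z = FreeMonoid.of a * w := by
  induction w using FreeMonoid.inductionOn' generalizing a with
  | one => exact ⟨FreeSemigroup.of a, by rw [FreeSemigroup.lift_of, mul_one]⟩
  | of_mul b w ih =>
    obtain ⟨z, hz⟩ := ih b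
    exact ⟨FreeSemigroup.of a * z, by rw [FreeSemigroup.lift_of_mul, hz]⟩

/-- If some letter acts trivially, then the syntactic semigroup is the whole syntactic monoid. -/
theorem SyntacticSemigroup.toMonoid_surjective {L : Language α} {a : α}
    (ha : ((FreeMonoid.of a : FreeMonoid α) : SyntacticMonoid L) = 1) :
    Function.Surjective (toMonoid L) := by
  intro x
  induction x using Con.induction_on with | _ x =>
  obtain ⟨z, hz⟩ := exists_freeSemigroup_lift_eq x a
  refine ⟨z, ?_⟩
  rw [toMonoid_coe, hz, Con.coe_mul, ha, one_mul]

end Syntactic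

/-! ### Minimal recognizers -/

/-- The action `f` of words on `Fin n`, with initial state `q` and accepting states `A`, is
a minimal automaton of `L`. -/
structure IsMinimalRecognizer {α : Type*} {n : ℕ} (f : FreeMonoid α →* Transf n) (q : Fin n)
    (A : Set (Fin n)) (L : Language α) : Prop where
  mem_iff : ∀ w : FreeMonoid α, w.toList ∈ L ↔ (f w).app q ∈ A
  reachable : ∀ p, ∃ w, (f w).app q = p
  separated : ∀ p p', (∀ w, (f w).app p ∈ A ↔ (f w).app p' ∈ A) → p = p'

namespace IsMinimalRecognizer

variable {α : Type*} {n : ℕ} {f : FreeMonoid α →* Transf n} {q : Fin n} {A : Set (Fin n)}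
  {L : Language α}

/-- Reachability turns left contexts `u` into arbitrary states, and separation lets right contexts
`v` tell states apart. -/
theorem syntacticCon_eq_ker (h : IsMinimalRecognizer f q A L) : syntacticCon L = Con.ker f := by
  ext x y
  rw [Con.ker_rel]
  constructor
  · intro hxy
    refine Transf.ext_app fun p => h.separated _ _ fun v => ?_
    obtain ⟨u, rfl⟩ := h.reachable p
    have := hxy u v
    rw [h.mem_iff, h.mem_iff] at this
    simpa only [map_mul, Transf.app_mul] using this
  · intro hxy u v
    rw [h.mem_iff, h.mem_iff]
    simp only [map_mul, hxy]

theorem nonempty_mulEquiv (h : IsMinimalRecognizer f q A L) :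
    Nonempty (SyntacticMonoid L ≃* MonoidHom.mrange f) := by
  unfold SyntacticMonoid
  rw [h.syntacticCon_eq_ker]
  exact ⟨Con.quotientKerEquivRange f⟩

theorem quotientComplexity_eq (h : IsMinimalRecognizer f q A L) : quotientComplexity L = n := by
  let R : Fin n → Language α := fun p => {v : List α | (f (FreeMonoid.ofList v)).app p ∈ A}
  have hR : Function.Injective R := fun p p' hp =>
    h.separated p p' fun w => Set.ext_iff.mp hp w.toList
  have hq : ∀ u : FreeMonoid α, L.leftQuotient u.toList = R ((f u).app q) := fun u => by
    refine Set.ext fun v => ?_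
    refine (h.mem_iff (u * FreeMonoid.ofList v)).trans ?_
    rw [map_mul, Transf.app_mul]
    rfl
  have hrange : Set.range L.leftQuotient = R '' Set.univ := by
    ext K
    constructor
    · rintro ⟨u, rfl⟩
      exact ⟨_, trivial, (hq (FreeMonoid.ofList u)).symm⟩
    · rintro ⟨p, -, rfl⟩
      obtain ⟨u, rfl⟩ := h.reachable p
      exact ⟨u.toList, hq u⟩
  rw [quotientComplexity, hrange, Set.ncard_image_of_injective _ hR, Set.ncard_univ,
    Nat.card_fin]

theorem isRegular (h : IsMinimalRecognizer f q A L) (hn : n ≠ 0) : L.IsRegular := by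
  apply Language.IsRegular.of_finite_range_leftQuotient
  apply Set.finite_of_ncard_ne_zero
  rw [← quotientComplexity, h.quotientComplexity_eq]
  exact hn

end IsMinimalRecognizer

/-- The action of words on the left quotients of a language. -/
theorem exists_isMinimalRecognizer {α : Type*} {L : Language α} {n : ℕ} (hn : n ≠ 0)
    (hL : quotientComplexity L = n) :
    ∃ (f : FreeMonoid α →* Transf n) (q : Fin n) (A : Set (Fin n)),
      IsMinimalRecognizer f q A L := by
  have hfin : (Set.range L.leftQuotient).Finite :=
    Set.finite_of_ncard_ne_zero (by rw [← quotientComplexity, hL]; exact hn)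
  have := hfin.to_subtype
  let e : Set.range L.leftQuotient ≃ Fin n := Finite.equivFinOfCardEq hL
  let act : List α → Set.range L.leftQuotient → Set.range L.leftQuotient := fun w K =>
    ⟨K.1.leftQuotient w, by
      obtain ⟨_, u, rfl⟩ := K
      exact ⟨u ++ w, Language.leftQuotient_append L u w⟩⟩
  let f : FreeMonoid α →* Transf n :=
    { toFun := fun w => Transf.ofFun fun i => e (act w.toList (e.symm i))
      map_one' := Transf.ext_app fun i => by
        rw [Transf.app_ofFun, Transf.app_one, ← Equiv.eq_symm_apply]
        rfl
      map_mul' := fun x y => Transf.ext_app fun i => by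
        rw [Transf.app_mul, Transf.app_ofFun, Transf.app_ofFun, Transf.app_ofFun,
          Equiv.symm_apply_apply]
        exact congrArg e (Subtype.ext (Language.leftQuotient_append _ _ _)) }
  have hf : ∀ w i, e.symm ((f w).app i) = act w.toList (e.symm i) := fun w i =>
    e.symm_apply_apply _
  have hact : ∀ (w : List α) (K : Set.range L.leftQuotient),
      [] ∈ (act w K).1 ↔ w ∈ K.1 := fun w K => by
    change w ++ [] ∈ K.1 ↔ _
    rw [List.append_nil]
  refine ⟨f, e ⟨L, [], rfl⟩, {i | [] ∈ (e.symm i).1}, ?_, ?_, ?_⟩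
  · intro w
    change _ ↔ [] ∈ (e.symm _).1
    rw [hf, hact, Equiv.symm_apply_apply]
  · intro p
    obtain ⟨u, hu⟩ := (e.symm p).2
    refine ⟨FreeMonoid.ofList u, e.symm.injective ?_⟩
    rw [hf, Equiv.symm_apply_apply]
    exact Subtype.ext hu
  · intro p p' h
    apply e.symm.injective
    refine Subtype.ext (Set.ext fun w => ?_)
    have := h (FreeMonoid.ofList w)
    change [] ∈ (e.symm _).1 ↔ [] ∈ (e.symm _).1 at this
    rw [hf, hf, hact, hact] at this
    exact this

theorem finite_and_syntacticComplexity_le {α : Type*} {L : Language α} {n : ℕ} [NeZero n]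
    (hJ : IsJTrivialLanguage L) (hL : quotientComplexity L = n) :
    Finite (SyntacticSemigroup L) ∧ syntacticComplexity L ≤ g n := by
  obtain ⟨f, q, A, h⟩ := exists_isMinimalRecognizer (NeZero.ne n) hL
  obtain ⟨e⟩ := h.nonempty_mulEquiv
  have : Finite (SyntacticMonoid L) := Finite.of_equiv _ e.symm.toEquiv
  refine ⟨Finite.of_injective _ (SyntacticSemigroup.toMonoid_injective L), ?_⟩
  calc syntacticComplexity L ≤ Nat.card (SyntacticMonoid L) :=
        Nat.card_le_card_of_injective _ (SyntacticSemigroup.toMonoid_injective L)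
    _ = Nat.card (MonoidHom.mrange f) := Nat.card_congr e.toEquiv
    _ ≤ g n := card_le_g_of_isJTrivial (hJ.of_mulEquiv e)

/-! ### Languages that meet the bound -/

theorem exists_surjective_of_card_le {α β : Type*} [Finite α] [Finite β] [Nonempty β]
    (h : Nat.card β ≤ Nat.card α) : ∃ φ : α → β, Function.Surjective φ := by
  have := Fintype.ofFinite α
  have := Fintype.ofFinite β
  rw [Nat.card_eq_fintype_card, Nat.card_eq_fintype_card] at h
  obtain ⟨i⟩ := Function.Embedding.nonempty_of_card_le h
  exact ⟨Function.invFun i, Function.invFun_surjective i.injective⟩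

theorem exists_witness_language {n : ℕ} [NeZero n] (α : Type*) [Finite α]
    (hα : 2 ^ (n - 1) ≤ Nat.card α) :
    ∃ L : Language α, L.IsRegular ∧ IsJTrivialLanguage L ∧ quotientComplexity L = n ∧
      syntacticComplexity L = g n ∧ Nonempty (SyntacticMonoid L ≃* SnSubmonoid n) ∧
      Nonempty (SyntacticSemigroup L ≃* SnSubmonoid n) := by
  have hone : (1 : Transf n) ∈ GSn n := ⟨Finset.univ, Finset.mem_univ _, generatorOf_univ.symm⟩
  have : Nonempty (GSn n) := ⟨⟨1, hone⟩⟩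
  obtain ⟨φ, hφ⟩ := exists_surjective_of_card_le (α := α) (β := GSn n)
    (by rw [Nat.card_coe_set_eq, ncard_GSn]; exact hα)
  let f : FreeMonoid α →* Transf n := FreeMonoid.lift fun a => (φ a : Transf n)
  have hf : MonoidHom.mrange f = SnSubmonoid n := by
    rw [FreeMonoid.mrange_lift, ← closure_GSn]
    congr 1
    exact (hφ.range_comp _).trans Subtype.range_coe
  have hgen : ∀ Z : Finset (Fin n), ⊤ ∈ Z → ∃ w, f w = generatorOf Z := fun Z hZ => by
    obtain ⟨a, ha⟩ := hφ ⟨_, Z, hZ, rfl⟩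
    exact ⟨FreeMonoid.of a, by rw [FreeMonoid.lift_eval_of, ha]⟩
  let L : Language α := {w : List α | (f (FreeMonoid.ofList w)).app ⊥ = ⊤}
  have hL : IsMinimalRecognizer f ⊥ {⊤} L := by
    -- The generator moving only `p` sends it to `⊤`; such words separate any two states.
    have hsend : ∀ p : Fin n, ∃ w, (f w).app p = ⊤ ∧ ∀ p' ≠ p, (f w).app p' = p' := by
      intro p
      by_cases hp : p = ⊤
      · exact ⟨1, by rw [map_one]; exact hp, fun p' _ => by rw [map_one]; rfl⟩
      obtain ⟨w, hw⟩ := hgen {p}ᶜ (by simpa using Ne.symm hp)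
      have happ := generatorOf_app (Z := {p}ᶜ) (h := p) (by simp) (by simp)
      refine ⟨w, ?_, fun p' hp' => ?_⟩
      · rw [hw, happ]; simp
      · rw [hw, happ]; simp [hp']
    refine ⟨fun w => Iff.rfl, fun p => ?_, ?_⟩
    · by_cases hp : p = ⊤
      · obtain ⟨w, hw, -⟩ := hsend ⊥
        exact ⟨w, hw.trans hp.symm⟩
      by_cases hp' : p = ⊥
      · exact ⟨1, by rw [map_one]; exact hp'.symm⟩
      have hbt : (⊥ : Fin n) ≠ ⊤ := fun h =>
        hp' (le_bot_iff.mp (h ▸ le_top))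
      -- Of the two moved points `p` is the larger, so this generator sends `⊥` to `p`.
      obtain ⟨w, hw⟩ := hgen {⊥, p}ᶜ (by simpa using ⟨hbt.symm, Ne.symm hp⟩)
      refine ⟨w, ?_⟩
      rw [hw, generatorOf_app (h := p) (by simp) fun i hi => ?_]
      swap
      · simp only [Finset.mem_compl, Finset.mem_insert, Finset.mem_singleton, not_not] at hi
        rcases hi with rfl | rfl
        · exact bot_le
        · exact le_rfl
      simp [Ne.symm hp']
    · have key : ∀ p p' : Fin n,
          (∀ w, (f w).app p ∈ ({⊤} : Set (Fin n)) ↔ (f w).app p' ∈ ({⊤} : Set (Fin n))) →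
            p' ≠ p → p' = ⊤ := by
        intro p p' h hne
        obtain ⟨w, hw, hw'⟩ := hsend p
        exact (hw' p' hne).symm.trans ((h w).mp hw)
      intro p p' h
      by_contra hne
      have h1 := key p p' h (Ne.symm hne)
      have h2 := key p' p (fun w => (h w).symm) hne
      exact hne (h2.trans h1.symm)
  obtain ⟨e⟩ : Nonempty (SyntacticMonoid L ≃* SnSubmonoid n) := hf ▸ hL.nonempty_mulEquiv
  -- A letter acting as the identity makes the empty word equivalent to a nonempty one.
  obtain ⟨a, ha⟩ := hφ ⟨1, hone⟩
  have ha' : ((FreeMonoid.of a : FreeMonoid α) : SyntacticMonoid L) = 1 := by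
    rw [← Con.coe_one, Con.eq, hL.syntacticCon_eq_ker, Con.ker_rel, map_one,
      FreeMonoid.lift_eval_of, ha]
  let e' : SyntacticSemigroup L ≃* SyntacticMonoid L :=
    MulEquiv.ofBijective (SyntacticSemigroup.toMonoid L)
      ⟨SyntacticSemigroup.toMonoid_injective L, SyntacticSemigroup.toMonoid_surjective ha'⟩
  refine ⟨L, hL.isRegular (NeZero.ne n), isJTrivial_SnSubmonoid.of_mulEquiv e.symm,
    hL.quotientComplexity_eq, ?_, ⟨e⟩, ⟨e'.trans e⟩⟩
  rw [syntacticComplexity, Nat.card_congr (e'.trans e).toEquiv, card_SnSubmonoid]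

end JTrivial

theorem mainTheorem2 (n : ℕ) [NeZero n] :
    -- the upper bound
    (∀ (α : Type*) [Finite α] (L : Language α),
      L.IsRegular → JTrivial.IsJTrivialLanguage L → JTrivial.quotientComplexity L = n →
        Finite (JTrivial.SyntacticSemigroup L) ∧
        JTrivial.syntacticComplexity L ≤ JTrivial.g n ∧
        JTrivial.syntacticComplexity L ≤ ⌊Real.exp 1 * ((n - 1).factorial : ℝ)⌋₊) ∧
    -- the closed form of the bound
    (2 ≤ n → JTrivial.g n = ⌊Real.exp 1 * ((n - 1).factorial : ℝ)⌋₊) ∧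
    -- the bound for monoids of non-decreasing transformations
    (∀ S : Submonoid (JTrivial.Transf n),
      S ≤ JTrivial.nonDecreasing n → JTrivial.IsJTrivial S → Nat.card S ≤ JTrivial.g n) ∧
    -- the set `S_n` is a `J`-trivial monoid that meets the bound, with an explicit generating set
    ∃ S : Submonoid (JTrivial.Transf n),
      (S : Set (JTrivial.Transf n)) = JTrivial.Sn n ∧
      S ≤ JTrivial.nonDecreasing n ∧
      JTrivial.IsJTrivial S ∧
      Nat.card S = JTrivial.g n ∧
      (JTrivial.GSn n).ncard = 2 ^ (n - 1) ∧
      Submonoid.closure (JTrivial.GSn n) = S ∧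
      -- the bound is met over every finite alphabet with at least `2 ^ (n - 1)` letters
      ∀ (α : Type*) [Finite α], 2 ^ (n - 1) ≤ Nat.card α →
        ∃ L : Language α,
          L.IsRegular ∧ JTrivial.IsJTrivialLanguage L ∧
          JTrivial.quotientComplexity L = n ∧
          JTrivial.syntacticComplexity L = JTrivial.g n ∧
          Nonempty (JTrivial.SyntacticMonoid L ≃* S) ∧
          Nonempty (JTrivial.SyntacticSemigroup L ≃* S) := by
  have hn : 1 ≤ n := NeZero.one_le
  refine ⟨fun α _ L _ hJ hL => ?_, JTrivial.g_eq_floor, fun S hS hJ => JTrivial.card_le_g hS hJ,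
    JTrivial.SnSubmonoid n, rfl, JTrivial.SnSubmonoid_le, JTrivial.isJTrivial_SnSubmonoid,
    JTrivial.card_SnSubmonoid, JTrivial.ncard_GSn, JTrivial.closure_GSn,
    fun α _ hα => JTrivial.exists_witness_language α hα⟩
  obtain ⟨hfin, hle⟩ := JTrivial.finite_and_syntacticComplexity_le hJ hL
  exact ⟨hfin, hle, hle.trans (JTrivial.g_le_floor hn)⟩
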